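/- **Setting.** A deterministic LOCAL algorithm $A$ for $3$-colouring is one fixed rule used by all nodes. Each node of a graph, whose nodes carry pairwise distinct natural numbers as identifiers, looks at the ball of radius $t=0,1,2,\dots$ around itself (its own identifier, the nodes at distance at most $t$, named by their identifiers, and all edges among them; the number $n$ of nodes of the graph is not given). The rule decides, as a function of this ball, whether the node continues or stops and outputs a colour in $\{1,2,3\}$. The radius $r(v)$ of a node $v$ is the first $t$ at which $v$ stops, so different nodes may stop at different radii. Let $\log^* n$ be the least number of times the binary logarithm has to be applied, starting from $n$, to reach a value at most $1$. **Theorem 1.** There are constants $c>0$ and $N\ge 3$ such that the following holds for every such algorithm $A$, every $n\ge N$ and every set $S$ of $n$ identifiers. Suppose that on the ring with $n$ nodes, for every placement of the identifiers of $S$ on its nodes (a bijection between nodes and $S$), every node stops and the outputs form a proper $3$-colouring. Then for some placement of the identifiers of $S$ on the ring, $$\frac1n\sum_{v} r(v)\ \ge\ c\,\log^* n .$$ In particular, if $A$ correctly $3$-colours all rings under all assignments of distinct identifiers, then for the worst-case placement its average radius on the $n$-node ring is $\Omega(\log^* n)$. -/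

import Mathlib

/-- Starting from any real number, some iterate of the binary logarithm is at most `1`. -/
theorem exists_iterate_logb_le_one (x : ℝ) : ∃ k : ℕ, (Real.logb 2)^[k] x ≤ 1 := by
  have key : ∀ m : ℕ, ∀ y : ℝ, y ≤ m + 1 → ∃ k : ℕ, (Real.logb 2)^[k] y ≤ 1 := by
    intro m
    induction m with
    | zero => exact fun y hy => ⟨0, by simpa using hy⟩
    | succ m ih =>
      intro y hy
      by_cases h1 : y ≤ 1
      · exact ⟨0, by simpa using h1⟩
      push Not at h1
      have hlog : Real.logb 2 y ≤ (m : ℝ) + 1 := by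
        rw [Real.logb_le_iff_le_rpow (by norm_num) (by linarith)]
        have hb : 1 + ((m + 1 : ℕ) : ℝ) * 1 ≤ (1 + (1 : ℝ)) ^ (m + 1) :=
          one_add_mul_le_pow (by norm_num) (m + 1)
        have hp : (2 : ℝ) ^ ((m : ℝ) + 1) = (1 + (1 : ℝ)) ^ (m + 1) := by
          rw [← Nat.cast_succ, Real.rpow_natCast]
          norm_num
        rw [hp]
        push_cast at hb hy
        linarith
      obtain ⟨k, hk⟩ := ih _ hlog
      exact ⟨k + 1, by simpa [Function.iterate_succ_apply] using hk⟩
  obtain ⟨m, hm⟩ := exists_nat_ge x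
  exact key m x (by linarith)

open Classical in
/-- The iterated logarithm `log* x`: the least number of times the binary logarithm has to be
applied, starting from `x`, until the value is at most `1`. -/
noncomputable def logStar (x : ℝ) : ℕ :=
  Nat.find (exists_iterate_logb_le_one x)

/-- What a node sees in the LOCAL model: its own identifier, and a graph whose
nodes are named by their (distinct) identifiers. The number of nodes of the network is not part of
the view. -/
@[ext]
structure LocalView where
  /-- the identifier of the node that looks -/
  center : ℕ
  /-- the identifiers of the nodes in sight -/
  nodes : Set ℕ
  /-- the edges in sight, as unordered pairs of identifiers -/
  edges : Set (Sym2 ℕ)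

/-- The ball of radius `t` around `v` in the graph `G` with identifiers `ident`: all nodes
at distance at most `t` from `v`, with all the edges of `G` between them. -/
def ballView {V : Type*} (G : SimpleGraph V) (ident : V ↪ ℕ) (v : V) (t : ℕ) : LocalView where
  center := ident v
  nodes := {a | ∃ u, G.edist v u ≤ t ∧ a = ident u}
  edges := {e | ∃ u w, G.edist v u ≤ t ∧ G.edist v w ≤ t ∧ G.Adj u w ∧ e = s(ident u, ident w)}

/-- A deterministic LOCAL algorithm with outputs in `α`. Each node increases the
radius of the ball that it sees, starting from `0`. On a view, `none` means that the node does not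
output yet, and `some a` means that it outputs `a`. -/
structure LocalAlgorithm (α : Type*) where
  /-- the decision rule, the same for all nodes of all networks -/
  rule : LocalView → Option α

namespace LocalAlgorithm

variable {α V : Type*}

/-- The radius `r(v)` of the node `v`: the first radius at which it outputs. (It is `0` by
convention if `v` never outputs, which `Colours` below excludes.) -/
noncomputable def radius (A : LocalAlgorithm α) (G : SimpleGraph V) (ident : V ↪ ℕ) (v : V) : ℕ :=
  sInf {t | (A.rule (ballView G ident v t)).isSome}

/-- The output of the node `v`; it is `none` exactly if `v` never outputs. -/
noncomputable def output (A : LocalAlgorithm α) (G : SimpleGraph V) (ident : V ↪ ℕ) (v : V) :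
    Option α :=
  A.rule (ballView G ident v (A.radius G ident v))

/-- Run on `G` with identifiers `ident`, every node outputs a colour, and the
outputs form a proper colouring of `G`. -/
def Colours (A : LocalAlgorithm α) (G : SimpleGraph V) (ident : V ↪ ℕ) : Prop :=
  ∃ C : G.Coloring α, ∀ v, A.output G ident v = some (C v)

/-- The average of the radii over the nodes, `(∑ v, r(v)) / n`. -/
noncomputable def averageRadius [Fintype V] (A : LocalAlgorithm α) (G : SimpleGraph V)
    (ident : V ↪ ℕ) : ℝ :=
  (∑ v, (A.radius G ident v : ℝ)) / Fintype.card V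

end LocalAlgorithm

/-!
Linial's bound says that some node must look at distance `Ω(log* n)`; for the average, the point is
that a node cannot be slow on its own. Fix `k`, of the order of `log* n`. Suppose that every node had
a node of radius at most `k` at distance at most `k` behind it. Then every node could be coloured
within radius `2 * k`: a node of radius at most `k` keeps its colour, and any other node takes the
parity of its distance to the nearest such node behind it, as one of two new colours
(`truncatedColor`). This is a proper `5`-colouring that depends on windows of `3 * k + 1` identifiers
(`truncatedColor_ne`, `truncatedColor_eq_of_placedAt`).

By Linial's argument (`card_le_iterate_of_window_coloring`), applied to increasing sequences, such a
colouring is impossible with more than a tower of `3 * k` twos, topped by a `5`, of identifiers.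
Hence any set of more identifiers than that contains `2 * k + 1` that form a crowded window: wherever
they stand consecutively, the first `k + 1` nodes have radii larger than `0, 1, …, k`, because their
balls of these radii lie inside the window (`exists_crowded_window`). So one window contributes
`Ω(k ^ 2)` to the sum of the radii with only `2 * k + 1` nodes. As long as half of the identifiers are
left, another disjoint window can be found, and placing all of them next to each other makes the sum
`Ω(n * k)` (`exists_list_sum_radius_ge`). The largest admissible `k` satisfies
`log* n ≤ 7 * (k + 1)` (`exists_scale`).
-/

/-! ### Locality on the ring -/

section Locality

open scoped Fin.CommRing

theorem SimpleGraph.Hom.edist_apply_le {V W : Type*} {G : SimpleGraph V} {H : SimpleGraph W}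
    (φ : G →g H) (u v : V) : H.edist (φ u) (φ v) ≤ G.edist u v := by
  refine le_iInf fun p => ?_
  simpa using (p.map φ).edist_le

theorem SimpleGraph.Iso.edist_apply {V W : Type*} {G : SimpleGraph V} {H : SimpleGraph W}
    (φ : G ≃g H) (u v : V) : H.edist (φ u) (φ v) = G.edist u v := by
  refine le_antisymm (SimpleGraph.Hom.edist_apply_le φ.toHom u v) ?_
  simpa using SimpleGraph.Hom.edist_apply_le φ.symm.toHom (φ u) (φ v)

/-- A ball view does not change under a graph isomorphism that preserves the identifiers in the
ball. -/
theorem ballView_eq_of_iso {V W : Type*} {G : SimpleGraph V} {H : SimpleGraph W}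
    (φ : G ≃g H) (ident : V ↪ ℕ) (ident' : W ↪ ℕ) (v : V) (t : ℕ)
    (h : ∀ u, G.edist v u ≤ t → ident u = ident' (φ u)) :
    ballView G ident v t = ballView H ident' (φ v) t := by
  have hc : ident v = ident' (φ v) := h v (by simp)
  have hnodes : ∀ x, (∃ u, G.edist v u ≤ t ∧ x = ident u) ↔
      ∃ u, H.edist (φ v) u ≤ t ∧ x = ident' u := fun x => by
    rw [φ.surjective.exists]
    refine exists_congr fun u => ?_
    rw [φ.edist_apply]
    exact and_congr_right fun hu => by rw [h u hu]
  have hedges : ∀ e, (∃ u w, G.edist v u ≤ t ∧ G.edist v w ≤ t ∧ G.Adj u w ∧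
      e = s(ident u, ident w)) ↔
      ∃ u w, H.edist (φ v) u ≤ t ∧ H.edist (φ v) w ≤ t ∧ H.Adj u w ∧
        e = s(ident' u, ident' w) := fun e => by
    rw [φ.surjective.exists₂]
    refine exists_congr fun u => exists_congr fun w => ?_
    rw [φ.edist_apply, φ.edist_apply, φ.map_adj_iff]
    exact and_congr_right fun hu => and_congr_right fun hw => by rw [h u hu, h w hw]
  exact LocalView.ext hc (Set.ext hnodes) (Set.ext hedges)

theorem cycleGraph_adj_iff_sub {m : ℕ} {u v : Fin (m + 1)}
    (h : (SimpleGraph.cycleGraph (m + 1)).Adj u v) : u - v = 1 ∨ v - u = 1 := by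
  rw [SimpleGraph.cycleGraph_eq_circulantGraph] at h
  simpa using h.2

/-- Rotation of the ring. -/
def cycleGraphRotation {m : ℕ} (d : Fin (m + 1)) :
    SimpleGraph.cycleGraph (m + 1) ≃g SimpleGraph.cycleGraph (m + 1) where
  toEquiv := Equiv.addRight d
  map_rel_iff' := by
    intro u v
    rw [SimpleGraph.cycleGraph_eq_circulantGraph]
    exact SimpleGraph.circulantGraph_adj_translate

theorem exists_eq_add_of_edist_le {m : ℕ} {a u : Fin (m + 1)} {t : ℕ}
    (h : (SimpleGraph.cycleGraph (m + 1)).edist (a + (t : Fin (m + 1))) u ≤ t) :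
    ∃ j ≤ 2 * t, u = a + (j : Fin (m + 1)) := by
  have walk : ∀ {v w : Fin (m + 1)} (p : (SimpleGraph.cycleGraph (m + 1)).Walk v w),
      ∃ i j : ℕ, i + j = p.length ∧ w + (i : Fin (m + 1)) = v + (j : Fin (m + 1)) := by
    intro v w p
    induction p with
    | nil => exact ⟨0, 0, by simp⟩
    | @cons u v w hadj p ih =>
      obtain ⟨i, j, hij, e⟩ := ih
      rcases cycleGraph_adj_iff_sub hadj with h1 | h1
      · refine ⟨i + 1, j, by simp; omega, ?_⟩
        push_cast
        linear_combination e - h1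
      · refine ⟨i, j + 1, by simp; omega, ?_⟩
        push_cast
        linear_combination e + h1
  obtain ⟨p, hp⟩ := SimpleGraph.exists_walk_of_edist_ne_top
    (ne_top_of_le_ne_top (ENat.natCast_ne_top t) h)
  rw [← hp] at h
  have hlen : p.length ≤ t := by exact_mod_cast h
  obtain ⟨i, j, hij, e⟩ := walk p
  refine ⟨t + j - i, by omega, ?_⟩
  rw [Nat.cast_sub (by omega)]
  push_cast
  linear_combination e

/-- The list `l` stands on the consecutive nodes `a, a + 1, …` of the ring. -/
def PlacedAt {m : ℕ} (ident : Fin (m + 1) ↪ ℕ) (a : Fin (m + 1)) (l : List ℕ) : Prop :=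
  ∀ i (h : i < l.length), ident (a + (i : Fin (m + 1))) = l[i]

theorem placedAt_append {m : ℕ} {ident : Fin (m + 1) ↪ ℕ} {a : Fin (m + 1)} {l l' : List ℕ} :
    PlacedAt ident a (l ++ l') ↔
      PlacedAt ident a l ∧ PlacedAt ident (a + (l.length : Fin (m + 1))) l' := by
  constructor
  · intro h
    refine ⟨fun i hi => ?_, fun i hi => ?_⟩
    · rw [h i (by simp; omega), List.getElem_append_left]
    · have := h (l.length + i) (by simp; omega)
      rw [List.getElem_append_right (by omega)] at this
      simpa [add_assoc] using this
  · rintro ⟨h1, h2⟩ i hi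
    rcases lt_or_ge i l.length with h | h
    · rw [h1 i h, List.getElem_append_left]
    · obtain ⟨j, rfl⟩ := Nat.exists_eq_add_of_le h
      rw [List.getElem_append_right (by omega)]
      have := h2 j (by simp at hi; omega)
      simpa [add_assoc] using this

/-- The ball of radius `t` around a node is determined by the identifiers on the `2 * t + 1` nodes
around it, wherever on the ring they stand. -/
theorem PlacedAt.ballView_eq {m : ℕ} {ident ident' : Fin (m + 1) ↪ ℕ} {a b : Fin (m + 1)}
    {l : List ℕ} (ha : PlacedAt ident a l) (hb : PlacedAt ident' b l) {s t : ℕ} (hts : t ≤ s)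
    (hst : s + t < l.length) :
    ballView (SimpleGraph.cycleGraph (m + 1)) ident (a + (s : Fin (m + 1))) t =
      ballView (SimpleGraph.cycleGraph (m + 1)) ident' (b + (s : Fin (m + 1))) t := by
  have e : b + (s : Fin (m + 1)) = cycleGraphRotation (b - a) (a + (s : Fin (m + 1))) := by
    simp only [cycleGraphRotation, RelIso.coe_fn_mk, Equiv.coe_addRight]
    ring
  rw [e]
  refine ballView_eq_of_iso _ _ _ _ _ fun u hu => ?_
  obtain ⟨r, rfl⟩ := Nat.exists_eq_add_of_le' hts
  rw [Nat.cast_add, ← add_assoc] at hu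
  obtain ⟨j, hj, rfl⟩ := exists_eq_add_of_edist_le hu
  have h1 := ha (r + j) (by omega)
  have h2 := hb (r + j) (by omega)
  rw [add_assoc, ← Nat.cast_add, h1, ← h2]
  congr 1
  simp only [cycleGraphRotation, RelIso.coe_fn_mk, Equiv.coe_addRight]
  ring

end Locality

/-! ### Radii and outputs -/

namespace LocalAlgorithm

variable {α V : Type*}

theorem Colours.exists_isSome {A : LocalAlgorithm α} {G : SimpleGraph V} {ident : V ↪ ℕ}
    (h : A.Colours G ident) (v : V) :
    (A.rule (ballView G ident v (A.radius G ident v))).isSome := by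
  obtain ⟨C, hC⟩ := h
  have := hC v
  rw [output] at this
  simp [this]

theorem Colours.radius_le_iff {A : LocalAlgorithm α} {G : SimpleGraph V} {ident : V ↪ ℕ}
    (h : A.Colours G ident) (v : V) (t : ℕ) :
    A.radius G ident v ≤ t ↔ ∃ s ≤ t, (A.rule (ballView G ident v s)).isSome :=
  ⟨fun ht => ⟨_, ht, h.exists_isSome v⟩, fun ⟨_, hs, hr⟩ => (Nat.sInf_le hr).trans hs⟩

open scoped Fin.CommRing

variable {A : LocalAlgorithm α} {m : ℕ} {ident ident' : Fin (m + 1) ↪ ℕ} {a b : Fin (m + 1)}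
  {l : List ℕ} {s t : ℕ}

theorem radius_le_iff_of_placedAt (hA : A.Colours (SimpleGraph.cycleGraph (m + 1)) ident)
    (hA' : A.Colours (SimpleGraph.cycleGraph (m + 1)) ident')
    (ha : PlacedAt ident a l) (hb : PlacedAt ident' b l) (hts : t ≤ s) (hst : s + t < l.length) :
    A.radius (SimpleGraph.cycleGraph (m + 1)) ident (a + (s : Fin (m + 1))) ≤ t ↔
      A.radius (SimpleGraph.cycleGraph (m + 1)) ident' (b + (s : Fin (m + 1))) ≤ t := by
  rw [hA.radius_le_iff, hA'.radius_le_iff]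
  refine exists_congr fun r => and_congr_right fun hr => ?_
  rw [ha.ballView_eq hb (hr.trans hts) (by omega)]

theorem output_eq_of_placedAt (hA : A.Colours (SimpleGraph.cycleGraph (m + 1)) ident)
    (hA' : A.Colours (SimpleGraph.cycleGraph (m + 1)) ident')
    (ha : PlacedAt ident a l) (hb : PlacedAt ident' b l) (hts : t ≤ s) (hst : s + t < l.length)
    (hr : A.radius (SimpleGraph.cycleGraph (m + 1)) ident (a + (s : Fin (m + 1))) ≤ t) :
    A.output (SimpleGraph.cycleGraph (m + 1)) ident (a + (s : Fin (m + 1))) =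
      A.output (SimpleGraph.cycleGraph (m + 1)) ident' (b + (s : Fin (m + 1))) := by
  have hr' := (radius_le_iff_of_placedAt hA hA' ha hb hts hst).1 hr
  have e : A.radius (SimpleGraph.cycleGraph (m + 1)) ident (a + (s : Fin (m + 1))) =
      A.radius (SimpleGraph.cycleGraph (m + 1)) ident' (b + (s : Fin (m + 1))) := by
    refine le_antisymm ?_ ?_
    · exact (radius_le_iff_of_placedAt hA hA' ha hb (hr'.trans hts) (by omega)).2 le_rfl
    · exact (radius_le_iff_of_placedAt hA hA' ha hb (hr.trans hts) (by omega)).1 le_rfl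
  rw [output, output, e, ha.ballView_eq hb (hr'.trans hts) (by omega)]

end LocalAlgorithm

/-! ### Linial's lower bound for windows of identifiers -/

/-- Linial's lower bound. If `f` colours the increasing sequences of `p + 1` elements of `T` such
that overlapping sequences get different colours, then `T` is at most a tower of `p` twos on top of
the number of colours. -/
theorem card_le_iterate_of_window_coloring (T : Finset ℕ) (p : ℕ) :
    ∀ {α : Type} [Fintype α] (f : List ℕ → α),
      (∀ x l z, l.length = p → (x :: (l ++ [z])).Pairwise (· < ·) →
        (∀ y ∈ x :: (l ++ [z]), y ∈ T) → f (x :: l) ≠ f (l ++ [z])) →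
      T.card ≤ (fun x => 2 ^ x)^[p] (Fintype.card α) := by
  classical
  induction p with
  | zero =>
    intro α _ f hf
    have hlt : ∀ x ∈ T, ∀ z ∈ T, x < z → f [x] ≠ f [z] := fun x hx z hz hxz =>
      hf x [] z rfl (by simpa using hxz) (by simp [hx, hz])
    refine Finset.card_le_card_of_injOn (fun x => f [x]) (fun _ _ => Finset.mem_univ _) ?_
    intro x hx z hz hxz
    by_contra hne
    rcases lt_or_gt_of_ne hne with h | h
    · exact hlt x hx z hz h hxz
    · exact hlt z hz x hx h hxz.symm
  | succ p ih =>
    intro α _ f hf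
    rw [Function.iterate_succ_apply, ← Fintype.card_set]
    -- The new colour of a sequence is the set of colours of its extensions to the left.
    refine ih (fun l => {c | ∃ x ∈ T, (x :: l).Pairwise (· < ·) ∧ f (x :: l) = c}) ?_
    intro y l z hl hs hT heq
    have hmem : f (y :: (l ++ [z])) ∈
        {c | ∃ x ∈ T, (x :: (l ++ [z])).Pairwise (· < ·) ∧ f (x :: (l ++ [z])) = c} :=
      ⟨y, hT y (by simp), hs, rfl⟩
    rw [← heq] at hmem
    obtain ⟨x, hx, hxs, hc⟩ := hmem
    refine hf x (y :: l) z (by simp [hl]) ?_ ?_ hc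
    · rw [List.cons_append, List.pairwise_cons]
      refine ⟨?_, hs⟩
      have hxy : x < y := by simpa using (List.pairwise_cons.1 hxs).1 y (by simp)
      intro w hw
      rcases List.mem_cons.1 hw with rfl | hw
      · exact hxy
      · exact hxy.trans ((List.pairwise_cons.1 hs).1 w hw)
    · intro w hw
      rcases List.mem_cons.1 hw with rfl | hw
      · exact hx
      · exact hT w hw

/-! ### The iterated logarithm and towers -/

theorem logStar_le_of_iterate_le {x : ℝ} {k : ℕ} (h : (Real.logb 2)^[k] x ≤ 1) : logStar x ≤ k := by
  classical
  exact Nat.find_min' _ h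

theorem logStar_le_of_le_iterate (j : ℕ) :
    ∀ x : ℝ, x ≤ ((fun y => 2 ^ y)^[j] 1 : ℕ) → logStar x ≤ j := by
  suffices H : ∀ x : ℝ, x ≤ ((fun y => 2 ^ y)^[j] 1 : ℕ) → ∃ k ≤ j, (Real.logb 2)^[k] x ≤ 1 by
    intro x hx
    obtain ⟨k, hk, h⟩ := H x hx
    exact (logStar_le_of_iterate_le h).trans hk
  induction j with
  | zero => exact fun x hx => ⟨0, le_rfl, by simpa using hx⟩
  | succ j ih =>
    intro x hx
    by_cases h1 : x ≤ 1
    · exact ⟨0, by simp, by simpa using h1⟩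
    rw [Function.iterate_succ_apply'] at hx
    obtain ⟨k, hk, h⟩ := ih (Real.logb 2 x) (by
      rw [Real.logb_le_iff_le_rpow (by norm_num) (by linarith), Real.rpow_natCast]
      exact_mod_cast hx)
    exact ⟨k + 1, by omega, by rwa [Function.iterate_succ_apply]⟩

theorem iterate_two_pow_mono (j : ℕ) : Monotone (fun y : ℕ => 2 ^ y)^[j] :=
  Monotone.iterate (fun _ _ h => Nat.pow_le_pow_right (by norm_num) h) j

theorem add_le_iterate_two_pow (x j : ℕ) : x + j ≤ (fun y : ℕ => 2 ^ y)^[j] x := by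
  induction j with
  | zero => simp
  | succ j ih =>
    rw [Function.iterate_succ_apply']
    exact ih.trans_lt Nat.lt_two_pow_self

theorem two_mul_add_one_le_two_pow {x : ℕ} (hx : 4 ≤ x) : 2 * (x + 1) ≤ 2 ^ x := by
  induction x, hx using Nat.le_induction with
  | base => norm_num
  | succ x hx ih => rw [pow_succ]; omega

/-- The largest scale `k` at which a `5`-colouring by windows of `3 * k + 1` identifiers is
impossible with half of the identifiers. It is of the order of `log* n`. -/
theorem exists_scale {n : ℕ} (hn : 12 ≤ n) :
    ∃ k : ℕ, 2 * ((fun x => 2 ^ x)^[3 * k] 5 + 1) ≤ n ∧ logStar (n : ℝ) ≤ 7 * (k + 1) := by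
  have hex : ∃ k : ℕ, n < 2 * ((fun x => 2 ^ x)^[3 * (k + 1)] 5 + 1) :=
    ⟨n, by have := add_le_iterate_two_pow 5 (3 * (n + 1)); omega⟩
  classical
  refine ⟨Nat.find hex, ?_, ?_⟩
  · rcases hk : Nat.find hex with _ | k
    · simpa using hn
    · have := Nat.find_min hex (m := k) (by omega)
      omega
  · set k := Nat.find hex
    have h1 := Nat.find_spec hex
    have h5 := add_le_iterate_two_pow 5 (3 * (k + 1))
    have h2 := two_mul_add_one_le_two_pow (x := (fun x => 2 ^ x)^[3 * (k + 1)] 5) (by omega)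
    rw [← Function.iterate_succ_apply' (fun x => 2 ^ x) (3 * (k + 1)) 5] at h2
    have h3 : (fun x => 2 ^ x)^[(3 * (k + 1)).succ] 5 ≤
        (fun x => 2 ^ x)^[(3 * (k + 1)).succ] ((fun x => 2 ^ x)^[3] 1) :=
      iterate_two_pow_mono _ (by norm_num)
    rw [← Function.iterate_add_apply] at h3
    refine (logStar_le_of_le_iterate ((3 * (k + 1)).succ + 3) n ?_).trans (by omega)
    exact_mod_cast (h1.le.trans h2).trans h3

/-! ### A five-colouring by windows, and crowded windows -/

section Rings

open scoped Fin.CommRing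

variable {m : ℕ}

/-- Any list of distinct identifiers of `S` can be placed on the ring, starting at the node `0`. -/
theorem exists_placedAt {S : Finset ℕ} (hS : S.card = m + 1) {l : List ℕ} (hl : l.Nodup)
    (hlS : ∀ x ∈ l, x ∈ S) :
    ∃ ident : Fin (m + 1) ↪ ℕ, Set.range ident = (S : Set ℕ) ∧ PlacedAt ident 0 l := by
  have hsub : l.toFinset ⊆ S := fun x hx => hlS x (by simpa using hx)
  set L := l ++ (S \ l.toFinset).toList with hL
  have hnd : L.Nodup := by
    rw [hL, List.nodup_append]
    refine ⟨hl, Finset.nodup_toList _, fun x hx y hy hxy => ?_⟩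
    subst hxy
    simp [hx] at hy
  have hlen : L.length = m + 1 := by
    have h1 := Finset.card_sdiff_add_card_eq_card hsub
    rw [List.toFinset_card_of_nodup hl] at h1
    simp only [hL, List.length_append, Finset.length_toList]
    omega
  have hmem : ∀ x, x ∈ L ↔ x ∈ S := fun x => by
    by_cases h : x ∈ l
    · simp [hL, h, hlS x h]
    · simp [hL, h]
  refine ⟨⟨fun i => L[(i : ℕ)]'(by omega), fun i j hij => ?inj⟩, ?_, fun i hi => ?_⟩
  case inj => exact Fin.ext ((hnd.getElem_inj_iff).1 hij)
  · ext x
    rw [Finset.mem_coe, ← hmem, List.mem_iff_getElem]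
    constructor
    · rintro ⟨i, rfl⟩
      exact ⟨i, by omega, rfl⟩
    · rintro ⟨i, hi, rfl⟩
      exact ⟨⟨i, by omega⟩, rfl⟩
  · have hi' : i < m + 1 := by
      rw [← hlen, hL, List.length_append]
      omega
    have hv : ((0 + (i : Fin (m + 1)) : Fin (m + 1)) : ℕ) = i := by
      rw [zero_add, Fin.val_natCast, Nat.mod_eq_of_lt hi']
    change L[((0 + (i : Fin (m + 1)) : Fin (m + 1)) : ℕ)]'_ = l[i]
    rw [getElem_congr_idx hv]
    exact List.getElem_append_left hi

/-- The number of steps from `v` backwards to the nearest node of radius at most `k`. (It is `0` if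
there is no such node; the lemmas about it assume that there is one.) -/
noncomputable def stepsBack (A : LocalAlgorithm (Fin 3)) (ident : Fin (m + 1) ↪ ℕ) (k : ℕ)
    (v : Fin (m + 1)) : ℕ :=
  sInf {d : ℕ | A.radius (SimpleGraph.cycleGraph (m + 1)) ident (v - (d : Fin (m + 1))) ≤ k}

open Classical in
/-- The colouring obtained from `A` by cutting it off at radius `k`: a node of radius at most `k`
keeps its output, and every other node takes, as one of two new colours, the parity of the number of
steps back to the nearest node of radius at most `k`. -/
noncomputable def truncatedColor (A : LocalAlgorithm (Fin 3)) (ident : Fin (m + 1) ↪ ℕ) (k : ℕ)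
    (v : Fin (m + 1)) : Fin 3 ⊕ Bool :=
  if A.radius (SimpleGraph.cycleGraph (m + 1)) ident v ≤ k then
    Sum.inl ((A.output (SimpleGraph.cycleGraph (m + 1)) ident v).getD 0)
  else Sum.inr (stepsBack A ident k v).bodd

variable {A : LocalAlgorithm (Fin 3)} {ident ident' : Fin (m + 1) ↪ ℕ} {a b v : Fin (m + 1)}
  {l : List ℕ} {k s : ℕ}

theorem stepsBack_add_one
    (h : ¬A.radius (SimpleGraph.cycleGraph (m + 1)) ident (v + 1) ≤ k)
    (hex : ∃ d : ℕ, A.radius (SimpleGraph.cycleGraph (m + 1)) ident (v - (d : Fin (m + 1))) ≤ k) :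
    stepsBack A ident k (v + 1) = stepsBack A ident k v + 1 := by
  have e : ∀ d : ℕ, v + 1 - ((d + 1 : ℕ) : Fin (m + 1)) = v - (d : Fin (m + 1)) := fun d => by
    push_cast
    ring
  have hmem := Nat.sInf_mem (s := {d : ℕ | A.radius (SimpleGraph.cycleGraph (m + 1)) ident
    (v + 1 - (d : Fin (m + 1))) ≤ k}) (by
      obtain ⟨d, hd⟩ := hex
      exact ⟨d + 1, by rw [Set.mem_ofPred_eq, e]; exact hd⟩)
  rw [stepsBack, stepsBack, ← Nat.sInf_add (n := 1)]
  · simp only [e]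
  · rw [Nat.one_le_iff_ne_zero]
    intro h0
    rw [h0] at hmem
    exact h (by simpa using hmem)

/-- The truncated colouring is proper wherever some node of radius at most `k` precedes. -/
theorem truncatedColor_ne (hA : A.Colours (SimpleGraph.cycleGraph (m + 1)) ident) (hm : m ≠ 0)
    (hex : ∃ d : ℕ, A.radius (SimpleGraph.cycleGraph (m + 1)) ident (v - (d : Fin (m + 1))) ≤ k) :
    truncatedColor A ident k v ≠ truncatedColor A ident k (v + 1) := by
  unfold truncatedColor
  split_ifs with h1 h2 h2
  · obtain ⟨C, hC⟩ := hA
    rw [hC, hC, Option.getD_some, Option.getD_some, Ne, Sum.inl.injEq]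
    refine C.valid ?_
    obtain ⟨m, rfl⟩ := Nat.exists_eq_succ_of_ne_zero hm
    rw [SimpleGraph.cycleGraph_eq_circulantGraph]
    simp
  · simp
  · simp
  · rw [stepsBack_add_one h2 hex, Nat.bodd_succ]
    simp

theorem radius_sub_le_iff_of_placedAt
    (hA : A.Colours (SimpleGraph.cycleGraph (m + 1)) ident)
    (hA' : A.Colours (SimpleGraph.cycleGraph (m + 1)) ident')
    (ha : PlacedAt ident a l) (hb : PlacedAt ident' b l) (hl : l.length = 3 * k + 1) {d : ℕ}
    (hd : d ≤ k) :
    A.radius (SimpleGraph.cycleGraph (m + 1)) ident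
        (a + ((2 * k : ℕ) : Fin (m + 1)) - (d : Fin (m + 1))) ≤ k ↔
      A.radius (SimpleGraph.cycleGraph (m + 1)) ident'
        (b + ((2 * k : ℕ) : Fin (m + 1)) - (d : Fin (m + 1))) ≤ k := by
  rw [add_sub_assoc, add_sub_assoc, ← Nat.cast_sub (by omega)]
  exact LocalAlgorithm.radius_le_iff_of_placedAt hA hA' ha hb (by omega) (by omega)

/-- The truncated colour depends on `3 * k + 1` identifiers only, if a node of radius at most `k` is
at most `k` steps back. -/
theorem truncatedColor_eq_of_placedAt (hA : A.Colours (SimpleGraph.cycleGraph (m + 1)) ident)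
    (hA' : A.Colours (SimpleGraph.cycleGraph (m + 1)) ident')
    (ha : PlacedAt ident a l) (hb : PlacedAt ident' b l) (hl : l.length = 3 * k + 1)
    (hex : ∃ d ≤ k, A.radius (SimpleGraph.cycleGraph (m + 1)) ident
        (a + ((2 * k : ℕ) : Fin (m + 1)) - (d : Fin (m + 1))) ≤ k) :
    truncatedColor A ident k (a + ((2 * k : ℕ) : Fin (m + 1))) =
      truncatedColor A ident' k (b + ((2 * k : ℕ) : Fin (m + 1))) := by
  have hiff := fun {d : ℕ} (hd : d ≤ k) =>
    radius_sub_le_iff_of_placedAt hA hA' ha hb hl hd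
  have hback : stepsBack A ident k (a + ((2 * k : ℕ) : Fin (m + 1))) =
      stepsBack A ident' k (b + ((2 * k : ℕ) : Fin (m + 1))) := by
    obtain ⟨d, hd, hr⟩ := hex
    have hle : stepsBack A ident k (a + ((2 * k : ℕ) : Fin (m + 1))) ≤ d := Nat.sInf_le hr
    have hr' := (hiff hd).1 hr
    have hle' : stepsBack A ident' k (b + ((2 * k : ℕ) : Fin (m + 1))) ≤ d := Nat.sInf_le hr'
    refine le_antisymm (Nat.sInf_le ?_) (Nat.sInf_le ?_)
    · exact (hiff (hle'.trans hd)).2 (Nat.sInf_mem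
        (s := {d : ℕ | A.radius (SimpleGraph.cycleGraph (m + 1)) ident'
          (b + ((2 * k : ℕ) : Fin (m + 1)) - (d : Fin (m + 1))) ≤ k}) ⟨d, hr'⟩)
    · exact (hiff (hle.trans hd)).1 (Nat.sInf_mem
        (s := {d : ℕ | A.radius (SimpleGraph.cycleGraph (m + 1)) ident
          (a + ((2 * k : ℕ) : Fin (m + 1)) - (d : Fin (m + 1))) ≤ k}) ⟨d, hr⟩)
  have h0 := LocalAlgorithm.radius_le_iff_of_placedAt (s := 2 * k) (t := k) hA hA' ha hb
    (by omega) (by omega)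
  unfold truncatedColor
  by_cases h : A.radius (SimpleGraph.cycleGraph (m + 1)) ident
      (a + ((2 * k : ℕ) : Fin (m + 1))) ≤ k
  · rw [if_pos h, if_pos (h0.1 h), LocalAlgorithm.output_eq_of_placedAt hA hA' ha hb (t := k)
      (by omega) (by omega) h]
  · rw [if_neg h, if_neg (fun h' => h (h0.2 h')), hback]

/-- Among sufficiently many identifiers there are `2 * k + 1` that force large radii when they stand
on consecutive nodes: the first `k + 1` of these nodes have radii larger than `0, 1, …, k`. If not,
every node would have a node of radius at most `k` at most `k` steps back, and the
truncated colouring would contradict Linial's bound. -/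
theorem exists_crowded_window {S T : Finset ℕ} (hS : S.card = m + 1) (hm : m ≠ 0)
    (hA : ∀ ident : Fin (m + 1) ↪ ℕ, Set.range ident = (S : Set ℕ) →
      A.Colours (SimpleGraph.cycleGraph (m + 1)) ident)
    (hTS : T ⊆ S) (k : ℕ) (hT : (fun x => 2 ^ x)^[3 * k] 5 < T.card) :
    ∃ w : List ℕ, w.Nodup ∧ (∀ x ∈ w, x ∈ T) ∧ w.length = 2 * k + 1 ∧
      ∀ ident : Fin (m + 1) ↪ ℕ, Set.range ident = (S : Set ℕ) →
        ∀ a, PlacedAt ident a w → ∀ j ≤ k,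
          j < A.radius (SimpleGraph.cycleGraph (m + 1)) ident (a + (j : Fin (m + 1))) := by
  classical
  by_contra! hno
  have hback : ∀ (ident : Fin (m + 1) ↪ ℕ) (a : Fin (m + 1)) (l : List ℕ),
      Set.range ident = (S : Set ℕ) → PlacedAt ident a l → l.Nodup → (∀ x ∈ l, x ∈ T) →
      l.length = 3 * k + 1 →
      ∃ d ≤ k, A.radius (SimpleGraph.cycleGraph (m + 1)) ident
        (a + ((2 * k : ℕ) : Fin (m + 1)) - (d : Fin (m + 1))) ≤ k := by
    intro ident a l hi hl hnd hlT hlen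
    obtain ⟨ident', hi', b, hb, j, hj, hr⟩ := hno (l.drop k) (hnd.sublist (List.drop_sublist _ _))
      (fun x hx => hlT x (List.mem_of_mem_drop hx)) (by simp; omega)
    have ha : PlacedAt ident (a + (k : Fin (m + 1))) (l.drop k) := by
      rw [← List.take_append_drop k l, placedAt_append] at hl
      simpa [hlen, show k ≤ 3 * k + 1 by omega] using hl.2
    refine ⟨k - j, by omega, ?_⟩
    have h2 := (LocalAlgorithm.radius_le_iff_of_placedAt (hA _ hi') (hA _ hi) hb ha le_rfl
      (by simp; omega)).1 hr
    have e : a + ((2 * k : ℕ) : Fin (m + 1)) - ((k - j : ℕ) : Fin (m + 1)) =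
        a + (k : Fin (m + 1)) + (j : Fin (m + 1)) := by
      rw [Nat.cast_sub hj]
      push_cast
      ring
    rw [e]
    exact h2.trans hj
  have hplace : ∀ l : List ℕ, ∃ ident : Fin (m + 1) ↪ ℕ, l.Nodup → (∀ x ∈ l, x ∈ T) →
      Set.range ident = (S : Set ℕ) ∧ PlacedAt ident 0 l := by
    intro l
    by_cases h : l.Nodup ∧ ∀ x ∈ l, x ∈ T
    · obtain ⟨ident, h'⟩ := exists_placedAt hS h.1 fun x hx => hTS (h.2 x hx)
      exact ⟨ident, fun _ _ => h'⟩
    · obtain ⟨ident, -⟩ := exists_placedAt hS List.nodup_nil (by simp)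
      exact ⟨ident, fun h1 h2 => absurd ⟨h1, h2⟩ h⟩
  choose place hplace using hplace
  refine hT.not_ge (card_le_iterate_of_window_coloring T (3 * k)
    (fun l => truncatedColor A (place l) k (0 + ((2 * k : ℕ) : Fin (m + 1)))) ?_)
  intro x l z hl hs hxT
  have hnd : (x :: (l ++ [z])).Nodup := hs.imp fun h => h.ne
  obtain ⟨hi, hp⟩ := hplace _ hnd hxT
  -- Compare both windows with one ring that carries all `3 * k + 2` identifiers.
  set ident := place (x :: (l ++ [z]))
  have hnd1 : (x :: l).Nodup := by
    rw [← List.cons_append] at hnd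
    exact hnd.sublist (List.sublist_append_left _ _)
  have hT1 : ∀ y ∈ x :: l, y ∈ T := fun y hy => hxT y (by
    rw [← List.cons_append]; exact List.mem_append_left _ hy)
  have hp1 : PlacedAt ident 0 (x :: l) := by
    rw [← List.cons_append, placedAt_append] at hp
    exact hp.1
  have hnd2 : (l ++ [z]).Nodup := (List.nodup_cons.1 hnd).2
  have hT2 : ∀ y ∈ l ++ [z], y ∈ T := fun y hy => hxT y (List.mem_cons_of_mem _ hy)
  have hp2 : PlacedAt ident (0 + 1) (l ++ [z]) := by
    have := (placedAt_append (l := [x])).1 hp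
    simpa using this.2
  obtain ⟨hi1, hq1⟩ := hplace _ hnd1 hT1
  obtain ⟨hi2, hq2⟩ := hplace _ hnd2 hT2
  have hb1 := hback ident 0 _ hi hp1 hnd1 hT1 (by simp [hl])
  rw [← truncatedColor_eq_of_placedAt (hA _ hi) (hA _ hi1) hp1 hq1 (by simp [hl]) hb1,
    ← truncatedColor_eq_of_placedAt (hA _ hi) (hA _ hi2) hp2 hq2 (by simp [hl])
      (hback ident _ _ hi hp2 hnd2 hT2 (by simp [hl])), add_right_comm 0 1]
  obtain ⟨d, -, hd⟩ := hb1
  exact truncatedColor_ne (hA _ hi) hm ⟨d, hd⟩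

/-! ### Many crowded windows on one ring -/

/-- Crowded windows, each contributing at least `1 + 2 + ⋯ + (k + 1)` to the sum of the radii, can be
placed next to each other as long as enough identifiers remain. -/
theorem exists_list_sum_radius_ge {S : Finset ℕ} (hS : S.card = m + 1) (hm : m ≠ 0)
    (hA : ∀ ident : Fin (m + 1) ↪ ℕ, Set.range ident = (S : Set ℕ) →
      A.Colours (SimpleGraph.cycleGraph (m + 1)) ident) (k M : ℕ)
    (hM : M * (2 * k + 1) + (fun x => 2 ^ x)^[3 * k] 5 ≤ m + 1) :
    ∃ l : List ℕ, l.Nodup ∧ (∀ x ∈ l, x ∈ S) ∧ l.length = M * (2 * k + 1) ∧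
      ∀ ident : Fin (m + 1) ↪ ℕ, Set.range ident = (S : Set ℕ) → PlacedAt ident 0 l →
        M * ∑ j ∈ Finset.range (k + 1), (j + 1) ≤ ∑ i ∈ Finset.range (M * (2 * k + 1)),
          A.radius (SimpleGraph.cycleGraph (m + 1)) ident (i : Fin (m + 1)) := by
  induction M with
  | zero => exact ⟨[], by simp⟩
  | succ M ih =>
    rw [Nat.succ_mul] at hM
    obtain ⟨l, hnd, hlS, hlen, hl⟩ := ih (by omega)
    have hsub : l.toFinset ⊆ S := fun x hx => hlS x (by simpa using hx)
    have hcard := Finset.card_sdiff_add_card_eq_card hsub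
    rw [List.toFinset_card_of_nodup hnd] at hcard
    obtain ⟨w, hwnd, hwT, hwlen, hw⟩ :=
      exists_crowded_window hS hm hA (T := S \ l.toFinset) Finset.sdiff_subset k (by omega)
    refine ⟨l ++ w, ?_, ?_, ?_, ?_⟩
    · rw [List.nodup_append]
      refine ⟨hnd, hwnd, fun x hx y hy hxy => ?_⟩
      subst hxy
      have := hwT x hy
      simp [hx] at this
    · intro x hx
      rcases List.mem_append.1 hx with h | h
      · exact hlS x h
      · exact Finset.sdiff_subset (hwT x h)
    · rw [List.length_append, hlen, hwlen, ← Nat.succ_mul]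
    · intro ident hi hp
      rw [placedAt_append, hlen, zero_add] at hp
      rw [Nat.succ_mul, Nat.succ_mul M (2 * k + 1),
        Finset.sum_range_add _ (M * (2 * k + 1))]
      refine add_le_add (hl ident hi hp.1) ?_
      calc ∑ j ∈ Finset.range (k + 1), (j + 1)
          ≤ ∑ j ∈ Finset.range (k + 1), A.radius (SimpleGraph.cycleGraph (m + 1)) ident
              ((M * (2 * k + 1) + j : ℕ) : Fin (m + 1)) := by
            refine Finset.sum_le_sum fun j hj => ?_
            rw [Nat.cast_add]
            exact hw ident hi _ hp.2 j (by rw [Finset.mem_range] at hj; omega)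
        _ ≤ _ := Finset.sum_le_sum_of_subset (Finset.range_mono (by omega))

theorem sum_radius_eq_sum_range (A : LocalAlgorithm (Fin 3)) (ident : Fin (m + 1) ↪ ℕ) :
    ∑ v, A.radius (SimpleGraph.cycleGraph (m + 1)) ident v =
      ∑ i ∈ Finset.range (m + 1),
        A.radius (SimpleGraph.cycleGraph (m + 1)) ident (i : Fin (m + 1)) := by
  rw [Finset.sum_range]
  simp

end Rings

/-! ### The average radius -/

/-- The average complexity of 3-colouring the ring with `n` nodes is `Ω(log* n)`. The constants
`c` and `N` do not depend on the algorithm `A`, nor on the set `S` of the `n` identifiers in use.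
The algorithm has to be correct on the `n`-node ring however the identifiers are placed, and the
bound is for the worst placement. -/
theorem theorem1 :
    ∃ c : ℝ, 0 < c ∧ ∃ N : ℕ, 3 ≤ N ∧
      ∀ (A : LocalAlgorithm (Fin 3)) (n : ℕ), N ≤ n →
        ∀ S : Finset ℕ, S.card = n →
          (∀ ident : Fin n ↪ ℕ, Set.range ident = (S : Set ℕ) →
            A.Colours (SimpleGraph.cycleGraph n) ident) →
          ∃ ident : Fin n ↪ ℕ, Set.range ident = (S : Set ℕ) ∧
            c * (logStar (n : ℝ) : ℝ) ≤ A.averageRadius (SimpleGraph.cycleGraph n) ident := by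
  refine ⟨1 / 112, by norm_num, 12, by norm_num, fun A n hn S hS hA => ?_⟩
  obtain ⟨k, hk, hlog⟩ := exists_scale hn
  have hgrow := add_le_iterate_two_pow 5 (3 * k)
  obtain ⟨m, rfl⟩ : ∃ m, n = m + 1 := ⟨n - 1, by omega⟩
  -- The crowded windows fill at most half of the ring, so that enough identifiers remain when each
  -- of them is chosen, and at least a quarter of it.
  set M := (m + 1) / (2 * (2 * k + 1)) with hMdef
  have hM1 : M * (2 * (2 * k + 1)) ≤ m + 1 := Nat.div_mul_le_self _ _
  have hM2 : m + 1 < (M + 1) * (2 * (2 * k + 1)) := by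
    rw [mul_comm]
    exact Nat.lt_mul_div_succ _ (by omega)
  have hM3 : 1 ≤ M := (Nat.one_le_div_iff (by omega)).2 (by omega)
  have hM4 : m + 1 ≤ 4 * (2 * k + 1) * M := by nlinarith
  obtain ⟨l, hnd, hlS, -, hl⟩ := exists_list_sum_radius_ge hS (by omega) hA k M (by
    have : M * (2 * (2 * k + 1)) = 2 * (M * (2 * k + 1)) := by ring
    omega)
  obtain ⟨ident, hi, hp⟩ := exists_placedAt hS hnd hlS
  refine ⟨ident, hi, ?_⟩
  have hsum : M * ∑ j ∈ Finset.range (k + 1), (j + 1) ≤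
      ∑ v, A.radius (SimpleGraph.cycleGraph (m + 1)) ident v := by
    rw [sum_radius_eq_sum_range]
    refine (hl ident hi hp).trans (Finset.sum_le_sum_of_subset (Finset.range_mono ?_))
    nlinarith
  have hgauss : (∑ j ∈ Finset.range (k + 1), (j + 1)) * 2 = (k + 2) * (k + 1) := by
    have := Finset.sum_range_id_mul_two (k + 2)
    rwa [Finset.sum_range_succ' _ (k + 1), add_zero] at this
  have hmain : (m + 1) * (k + 1) ≤ 16 * ∑ v, A.radius (SimpleGraph.cycleGraph (m + 1)) ident v := by
    calc (m + 1) * (k + 1) ≤ (4 * (2 * k + 1) * M) * (k + 1) := Nat.mul_le_mul_right _ hM4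
      _ ≤ 8 * M * ((k + 2) * (k + 1)) := by nlinarith [Nat.zero_le (M * (k + 1))]
      _ = 16 * (M * ∑ j ∈ Finset.range (k + 1), (j + 1)) := by rw [← hgauss]; ring
      _ ≤ _ := Nat.mul_le_mul_left _ hsum
  rw [LocalAlgorithm.averageRadius, Fintype.card_fin, le_div_iff₀ (by positivity)]
  have h1 : (logStar ((m + 1 : ℕ) : ℝ) : ℝ) ≤ 7 * (k + 1) := by exact_mod_cast hlog
  have h2 : ((m + 1 : ℕ) : ℝ) * (k + 1) ≤
      16 * ∑ v, (A.radius (SimpleGraph.cycleGraph (m + 1)) ident v : ℝ) := by exact_mod_cast hmain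
  have h3 := mul_le_mul_of_nonneg_right h1 (Nat.cast_nonneg (α := ℝ) (m + 1))
  linarith
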